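/- Consider the $(K,N,N_r,K_c,M)$ distributed linearly separable computation problem with $1\le N_r\le N$, $N\mid K$ and $1\le K_c\le K$. There are $K$ messages $W_1,\dots,W_K\in\mathbb F_q^L$ ($L\ge 1$, $q$ a prime power), and a master wants $\mathbf F\,[W_1;\dots;W_K]$, where the request matrix $\mathbf F\in\mathbb F_q^{K_c\times K}$ is known to the master and to the $N$ workers; all entries of $\mathbf F$ and of $W_1,\dots,W_K$ are independent and uniform on $\mathbb F_q$. A scheme consists of sets $\mathcal Z_n\subseteq[K]$ with $|\mathcal Z_n|\le M$ (the messages available to worker $n\in[N]$), encoding functions giving $X_n\in\mathbb F_q^{T_n}$ from $\{W_k:k\in\mathcal Z_n\}$ and $\mathbf F$, and, for each $\mathcal A\subseteq[N]$ with $|\mathcal A|=N_r$, a decoding function giving an estimate of $\mathbf F\,[W_1;\dots;W_K]$ from $\{X_n:n\in\mathcal A\}$ and $\mathbf F$. Its error $\varepsilon$ is the maximum over such $\mathcal A$ of the probability that the estimate is wrong, and its communication cost is $\max_{\mathcal A}\sum_{n\in\mathcal A}T_n/L$. A cost $R$ is achievable with message length $L$ and a given assignment if there are schemes, one over each finite field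 $\mathbb F_q$, with that message length, assignment and cost $R$, such that $\varepsilon\to0$ as $q\to\infty$. Theorem. Let $M=\frac KN(N-N_r+1)$ and let the assignment be the cyclic one, $$\mathcal Z_n=\bigcup_{p=0}^{K/N-1}\{\mathrm{Mod}(n+j,N)+pN:\ 0\le j\le N-N_r\},\qquad n\in[N],$$ where $\mathrm{Mod}(b,N)\in\{1,\dots,N\}$ is the residue of $b$ modulo $N$. Then the following communication costs are achievable: - $N_rK_c$ if $K_c<\frac KN$, for every message length $L\ge1$; - $\frac KN N_r$ if $\frac KN\le K_c\le\frac KN N_r$, for every message length $L\ge1$; - $K_c$ if $\frac KN N_r<K_c\le K$, for every positive message length $L$ divisible by $\binom{K_c-1}{\frac KN N_r-1}$. -/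

import Mathlib

/-- A computation scheme for the `(K, N, Nr, Kc, M)` distributed linearly separable computation
problem over the field `𝔽`, for messages of `L` symbols each.

Datasets (equivalently messages) are indexed by `Fin K`, workers by `Fin N`. The request matrix is
a `Kc × K` matrix over `𝔽`, known to the master and to all workers. -/
structure Scheme (𝔽 : Type) [Field 𝔽] (K N Nr Kc M L : ℕ) where
  /-- Data assignment: the set of datasets given to each worker (may depend on the request). -/
  assign : Matrix (Fin Kc) (Fin K) 𝔽 → Fin N → Finset (Fin K)
  /-- The computation cost constraint. -/
  card_assign_le : ∀ F n, (assign F n).card ≤ M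
  /-- The number of symbols sent by each worker. -/
  T : Fin N → ℕ
  /-- The encoding function of worker `n`: it sees only the messages of its assigned datasets,
  and the request matrix `F`. -/
  encode : (n : Fin N) → (F : Matrix (Fin Kc) (Fin K) 𝔽) →
    (assign F n → Fin L → 𝔽) → (Fin (T n) → 𝔽)
  /-- The decoding functions of the master, one for every set `A` of `Nr` responding workers. -/
  decode : (A : {A : Finset (Fin N) // A.card = Nr}) →
    ((n : A.1) → Fin (T n.1) → 𝔽) → Matrix (Fin Kc) (Fin K) 𝔽 → Matrix (Fin Kc) (Fin L) 𝔽

namespace Scheme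

variable {𝔽 : Type} [Field 𝔽] {K N Nr Kc M L : ℕ}

/-- The output of the master when the workers in `A` respond, for the request matrix `F` and the
messages `W` (row `k` of `W` is the `k`-th message). -/
def output (S : Scheme 𝔽 K N Nr Kc M L) (A : {A : Finset (Fin N) // A.card = Nr})
    (F : Matrix (Fin Kc) (Fin K) 𝔽) (W : Matrix (Fin K) (Fin L) 𝔽) :
    Matrix (Fin Kc) (Fin L) 𝔽 :=
  S.decode A (fun n => S.encode n.1 F (fun k => W k.1)) F

/-- The probability that the output for the responding set `A` differs from `F * W`, where all
entries of `F` and of `W` are independent and uniform on `𝔽`, that is, `(F, W)` is uniform on the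
finite set of all pairs of matrices. -/
noncomputable def errorProbAt (S : Scheme 𝔽 K N Nr Kc M L)
    (A : {A : Finset (Fin N) // A.card = Nr}) : ℝ :=
  (Nat.card {p : Matrix (Fin Kc) (Fin K) 𝔽 × Matrix (Fin K) (Fin L) 𝔽 //
      S.output A p.1 p.2 ≠ p.1 * p.2} : ℝ) /
    (Nat.card (Matrix (Fin Kc) (Fin K) 𝔽 × Matrix (Fin K) (Fin L) 𝔽) : ℝ)

/-- The worst-case error probability over all sets of `Nr` responding workers. -/
noncomputable def errorProb (S : Scheme 𝔽 K N Nr Kc M L) : ℝ :=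
  ⨆ A : {A : Finset (Fin N) // A.card = Nr}, S.errorProbAt A

/-- The communication cost: the maximal number of symbols received from `Nr` workers, normalized
by the message length. -/
noncomputable def commCost (S : Scheme 𝔽 K N Nr Kc M L) : ℝ :=
  ⨆ A : {A : Finset (Fin N) // A.card = Nr}, (∑ n ∈ A.1, (S.T n : ℝ)) / (L : ℝ)

end Scheme

/-- The cyclic assignment. With datasets and workers numbered from `0`, worker `n` gets the
datasets `((n + j) mod N) + p * N` for `0 ≤ j ≤ N - Nr` and `0 ≤ p ≤ K / N - 1`. -/
def cyclicAssignment (K N Nr : ℕ) (n : Fin N) : Finset (Fin K) :=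
  Finset.univ.filter fun k : Fin K =>
    ∃ p : Fin (K / N), ∃ j : Fin (N - Nr + 1),
      (k : ℕ) = ((n : ℕ) + (j : ℕ)) % N + (p : ℕ) * N

/-- The communication cost `R` is achievable with the fixed data assignment `Z`, computation cost
`M` and message length `L`: there are schemes, one over every finite field, that all use the
assignment `Z` and have communication cost `R`, and whose worst-case error probability tends to
`0` as the field size tends to infinity. -/
def IsAchievableWith (K N Nr Kc M L : ℕ) (Z : Fin N → Finset (Fin K)) (R : ℝ) : Prop :=
  ∃ S : (𝔽 : Type) → [Field 𝔽] → [Finite 𝔽] → Scheme 𝔽 K N Nr Kc M L,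
    (∀ (𝔽 : Type) [Field 𝔽] [Finite 𝔽],
      (∀ F n, (S 𝔽).assign F n = Z n) ∧ (S 𝔽).commCost = R) ∧
    ∀ ε : ℝ, 0 < ε → ∃ q₀ : ℕ, ∀ (𝔽 : Type) [Field 𝔽] [Finite 𝔽],
      q₀ ≤ Nat.card 𝔽 → (S 𝔽).errorProb ≤ ε

/-! Put `m = K / N` and let `G` have `m * Nr` rows and `m * N` columns. Worker `n` lacks the columns
in `Nr - 1` residue classes, `m * (Nr - 1)` in all, so at least `m` independent row vectors kill
those columns. It sends these vectors times `G * V`, which involves only messages it holds. If the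
vectors of any `Nr` workers stack to a nonsingular square matrix, the master recovers `G * V`.

Taking the vectors from an adjugate makes the stacked determinant an integral polynomial in `G` and
in auxiliary completion columns. A block diagonal witness shows that it is nonzero over every field
(`det_stackedAnnihilators_generic_ne_zero`), and Schwartz–Zippel bounds the fraction of bad `F` by a
constant over `q` (`exists_forall_card_bad_le`).

The regimes differ in `G`. For few requests, each row of `F` is served alone by a code with `m = 1`,
after merging messages of equal residue. In the middle regime `F` is padded with free rows to `m *
Nr` rows. For many requests, the square-count code runs on every set of `m * Nr` rows of `F`,
applied to Vandermonde combinations of message pieces; each row lies in exactly as many sets as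
there are pieces. -/

open Matrix

/-! ### Cyclic windows of workers -/

/-- The residue `(n + j) mod N`. -/
def cyclicShift {N : ℕ} (n : Fin N) (j : ℕ) : Fin N := ⟨(n + j) % N, Nat.mod_lt _ n.pos⟩

/-- The residue `r` lies in the window `n, n + 1, …, n + (N - Nr)` modulo `N`. -/
def InWindow {N : ℕ} (Nr : ℕ) (n r : Fin N) : Prop := ∃ j ≤ N - Nr, r = cyclicShift n j

theorem cyclicShift_inj {N : ℕ} {n : Fin N} {i j : ℕ} (hi : i < N) (hj : j < N) :
    cyclicShift n i = cyclicShift n j ↔ i = j := by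
  refine ⟨fun h => ?_, fun h => h ▸ rfl⟩
  have h' : (n + i) % N = (n + j) % N := congrArg Fin.val h
  have h2 : i ≡ j [MOD N] := Nat.ModEq.add_left_cancel' (n : ℕ) h'
  exact Nat.ModEq.eq_of_lt_of_lt h2 hi hj

theorem not_inWindow_cyclicShift {N Nr : ℕ} (hNr : Nr ≤ N) (n : Fin N) {t : ℕ} (ht : t ≠ 0)
    (htN : t < Nr) : ¬ InWindow Nr n (cyclicShift n (N - Nr + t)) := by
  rintro ⟨j, hj, h⟩
  rw [cyclicShift_inj (by omega) (by omega)] at h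
  omega

/-- The value `t = 0` would give the last residue inside the window, so that slot stays free for the
completion columns. -/
theorem exists_eq_cyclicShift_of_not_inWindow {N Nr : ℕ} (hNr : Nr ≤ N) {n r : Fin N}
    (h : ¬ InWindow Nr n r) : ∃ t : Fin Nr, (t : ℕ) ≠ 0 ∧ r = cyclicShift n (N - Nr + t) := by
  have key : ∃ j < N, r = cyclicShift n j := by
    by_cases hrn : n ≤ r
    · refine ⟨r - n, by omega, Fin.ext ?_⟩
      simp only [cyclicShift]
      rw [show (n : ℕ) + (r - n) = r from by have : (n : ℕ) ≤ r := hrn; omega,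
        Nat.mod_eq_of_lt r.2]
    · have hlt : (r : ℕ) < n := by simpa using hrn
      refine ⟨N + r - n, by omega, Fin.ext ?_⟩
      simp only [cyclicShift]
      rw [show (n : ℕ) + (N + r - n) = r + N from by omega, Nat.add_mod_right,
        Nat.mod_eq_of_lt r.2]
  obtain ⟨j, hj, rfl⟩ := key
  have hj' : ¬ j ≤ N - Nr := fun hle => h ⟨j, hle, rfl⟩
  exact ⟨⟨j - (N - Nr), by omega⟩, by simp; omega, by congr 1; simp; omega⟩

theorem le_sub_of_strictMono {N Nr : ℕ} {a : Fin Nr → Fin N} (ha : StrictMono a) {i j : Fin Nr}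
    (hij : i ≤ j) : (j : ℕ) - i ≤ (a j : ℕ) - a i := by
  have key : ∀ d : ℕ, ∀ (h : (i : ℕ) + d < Nr), (a i : ℕ) + d ≤ a ⟨i + d, h⟩ := by
    intro d
    induction d with
    | zero => intro h; simp
    | succ d ih =>
      intro h
      have h1 := ih (by omega)
      have h2 : a ⟨i + d, by omega⟩ < a ⟨i + (d + 1), h⟩ := ha (by simp [Fin.lt_def])
      have h3 : (a ⟨i + d, by omega⟩ : ℕ) < a ⟨i + (d + 1), h⟩ := h2
      omega
  have hij' : (i : ℕ) ≤ j := hij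
  have := key (j - i) (by omega)
  have hj : (⟨(i : ℕ) + (j - i), by omega⟩ : Fin Nr) = j := Fin.ext (by simp; omega)
  rw [hj] at this
  omega

/-- The `t`-th worker of a responding set after `a i` holds the `t`-th residue outside of the
window of `a i`. -/
theorem inWindow_of_strictMono {N Nr : ℕ} [NeZero Nr] (hNr : Nr ≤ N) {a : Fin Nr → Fin N}
    (ha : StrictMono a) (i j : Fin Nr) (hij : i ≠ j) :
    InWindow Nr (a j) (cyclicShift (a i) (N - Nr + (j - i : Fin Nr))) := by
  have hN0 : 0 < Nr := i.pos
  -- Strict monotonicity confines `a k` to `[k, N - Nr + k]` and makes gaps in `a` at least gaps in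
  -- the index; both cases need only this.
  have lo : ∀ k : Fin Nr, (k : ℕ) ≤ a k := by
    intro k
    have := le_sub_of_strictMono ha (i := ⟨0, hN0⟩) (j := k) (Nat.zero_le _)
    simp at this; omega
  have hi : ∀ k : Fin Nr, (a k : ℕ) + (Nr - k) ≤ N := by
    intro k
    have := le_sub_of_strictMono ha (i := k) (j := ⟨Nr - 1, by omega⟩)
      (Fin.le_def.mpr (by simp; omega))
    have h2 := (a ⟨Nr - 1, by omega⟩).2
    simp at this; omega
  have hli := lo i
  have hlj := lo j
  have hui := hi i
  have huj := hi j
  have hiN := i.2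
  have hjN := j.2
  rcases lt_or_gt_of_ne hij with h | h
  · have hs : ((j - i : Fin Nr) : ℕ) = j - i := Fin.sub_val_of_le h.le
    have hd := le_sub_of_strictMono ha h.le
    have hlt : (a i : ℕ) < a j := ha h
    have h' : (i : ℕ) < j := h
    refine ⟨a i + (N - Nr + (j - i)) - a j, by omega, Fin.ext ?_⟩
    simp only [cyclicShift, hs]
    congr 1
    omega
  -- Here `j - i` wraps modulo `Nr` and the residue wraps modulo `N`.
  · have hs : ((j - i : Fin Nr) : ℕ) = Nr + j - i := by
      rw [Fin.coe_sub_iff_lt.mpr h]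
    have hd := le_sub_of_strictMono ha h.le
    have hlt : (a j : ℕ) < a i := ha h
    have h' : (j : ℕ) < i := h
    refine ⟨a i + (N - Nr + (Nr + j - i)) - N - a j, by omega, Fin.ext ?_⟩
    simp only [cyclicShift, hs]
    refine (congrArg (· % N) ?_).trans (Nat.add_mod_right _ N)
    omega

/-! ### Encoding matrices obtained from cofactors -/

section Code

variable {A B : Type*} [CommRing A] [CommRing B] {m N Nr : ℕ}

/-- The columns of `G` outside of the window of worker `n`, completed by the columns of `C` to a
square matrix. -/
def completedColumns (G : Matrix (Fin m × Fin Nr) (Fin m × Fin N) A)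
    (C : Fin N → Matrix (Fin m × Fin Nr) (Fin m) A) (n : Fin N) :
    Matrix (Fin m × Fin Nr) (Fin m × Fin Nr) A :=
  Matrix.of fun x y =>
    if (y.2 : ℕ) = 0 then C n x y.1 else G x (y.1, cyclicShift n (N - Nr + y.2))

/-- Row vectors annihilating the columns of `G` outside of the window of worker `n`: rows of the
adjugate of the completed matrix. -/
def annihilator [NeZero Nr] (G : Matrix (Fin m × Fin Nr) (Fin m × Fin N) A)
    (C : Fin N → Matrix (Fin m × Fin Nr) (Fin m) A) (n : Fin N) :
    Matrix (Fin m) (Fin m × Fin Nr) A :=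
  (completedColumns G C n).adjugate.submatrix (fun p => (p, 0)) id

/-- The annihilators of the workers `a 0, a 1, …`, stacked to a square matrix. -/
def stackedAnnihilators [NeZero Nr] (G : Matrix (Fin m × Fin Nr) (Fin m × Fin N) A)
    (C : Fin N → Matrix (Fin m × Fin Nr) (Fin m) A) (a : Fin Nr → Fin N) :
    Matrix (Fin m × Fin Nr) (Fin m × Fin Nr) A :=
  Matrix.of fun x y => annihilator G C (a x.2) x.1 y

theorem completedColumns_map (f : A →+* B) (G : Matrix (Fin m × Fin Nr) (Fin m × Fin N) A)
    (C : Fin N → Matrix (Fin m × Fin Nr) (Fin m) A) (n : Fin N) :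
    (completedColumns G C n).map f = completedColumns (G.map f) (fun n => (C n).map f) n := by
  ext x y
  simp only [completedColumns, Matrix.map_apply, Matrix.of_apply]
  split_ifs <;> rfl

theorem map_det_stackedAnnihilators [NeZero Nr] (f : A →+* B)
    (G : Matrix (Fin m × Fin Nr) (Fin m × Fin N) A)
    (C : Fin N → Matrix (Fin m × Fin Nr) (Fin m) A) (a : Fin Nr → Fin N) :
    f (stackedAnnihilators G C a).det =
      (stackedAnnihilators (G.map f) (fun n => (C n).map f) a).det := by
  rw [RingHom.map_det]
  congr 1
  ext x y
  simp only [stackedAnnihilators, annihilator, RingHom.mapMatrix_apply, Matrix.map_apply,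
    Matrix.of_apply, Matrix.submatrix_apply]
  rw [← completedColumns_map, ← RingHom.mapMatrix_apply, ← RingHom.map_adjugate]
  rfl

theorem annihilator_mul_apply_eq_zero [NeZero Nr] (hNr : Nr ≤ N)
    (G : Matrix (Fin m × Fin Nr) (Fin m × Fin N) A)
    (C : Fin N → Matrix (Fin m × Fin Nr) (Fin m) A) {n : Fin N} (p : Fin m)
    {k : Fin m × Fin N} (hk : ¬ InWindow Nr n k.2) : (annihilator G C n * G) p k = 0 := by
  obtain ⟨t, ht, hr⟩ := exists_eq_cyclicShift_of_not_inWindow hNr hk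
  -- An off-diagonal entry of `adjugate Q * Q = det Q • 1`, as `t ≠ 0`.
  have h := congrFun (congrFun (Matrix.adjugate_mul (completedColumns G C n)) (p, 0)) (k.1, t)
  have ht0 : (0 : Fin Nr) ≠ t := fun h0 => ht (by rw [← h0]; simp)
  rw [Matrix.smul_apply, Matrix.one_apply_ne (by simp [ht0]), smul_zero] at h
  rw [← h, Matrix.mul_apply, Matrix.mul_apply]
  refine Finset.sum_congr rfl fun x _ => ?_
  have hk' : k = (k.1, cyclicShift n (N - Nr + t)) := Prod.ext rfl hr
  simp only [annihilator, Matrix.submatrix_apply, id, completedColumns, Matrix.of_apply, if_neg ht]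
  rw [← hk']

theorem eq_zero_of_annihilator_mul_eq_zero [IsDomain A] [NeZero Nr] {l : Type*}
    (G : Matrix (Fin m × Fin Nr) (Fin m × Fin N) A)
    (C : Fin N → Matrix (Fin m × Fin Nr) (Fin m) A) (a : Fin Nr → Fin N)
    (ha : (stackedAnnihilators G C a).det ≠ 0) (V : Matrix (Fin m × Fin Nr) l A)
    (hV : ∀ i, annihilator G C (a i) * V = 0) : V = 0 := by
  ext x c
  have : (fun x => V x c) = 0 := by
    refine Matrix.eq_zero_of_mulVec_eq_zero ha (funext fun y => ?_)
    have := congrFun (congrFun (hV y.2) y.1) c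
    simpa [Matrix.mul_apply, Matrix.mulVec, dotProduct, stackedAnnihilators] using this
  exact congrFun this x

end Code

/-! ### Nonsingularity at a structured point -/

section Witness

variable {𝔽 : Type*} [Field 𝔽] {m N Nr : ℕ}

open Classical in
/-- A block diagonal matrix, all of whose blocks are `b` with the entries outside of the windows of
the workers `a i` deleted. -/
noncomputable def blockWindowMatrix (m : ℕ) {A : Type*} [CommRing A] (a : Fin Nr → Fin N)
    (b : Fin Nr → Fin N → A) : Matrix (Fin m × Fin Nr) (Fin m × Fin N) A :=
  Matrix.of fun x k => if x.1 = k.1 ∧ InWindow Nr (a x.2) k.2 then b x.2 k.2 else 0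

/-- The columns that turn the annihilator of worker `a i` into unit vectors. -/
def unitCompletion (m : ℕ) (A : Type*) [CommRing A] (a : Fin Nr → Fin N) (n : Fin N) :
    Matrix (Fin m × Fin Nr) (Fin m) A :=
  Matrix.of fun x p => if x.1 = p ∧ a x.2 = n then 1 else 0

/-- Row `x` of the completed matrix `Q` of worker `a x.2` is the unit vector at `(x.1, 0)`, so row
`x` of `Q * adjugate Q = det Q • 1` reads off the annihilator. -/
theorem stackedAnnihilators_blockWindowMatrix {A : Type*} [CommRing A] [NeZero Nr] (hNr : Nr ≤ N)
    {a : Fin Nr → Fin N} (b : Fin Nr → Fin N → A) :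
    stackedAnnihilators (blockWindowMatrix m a b) (unitCompletion m A a) a =
      Matrix.diagonal fun x =>
        (completedColumns (blockWindowMatrix m a b) (unitCompletion m A a) (a x.2)).det := by
  ext x y
  set Q := completedColumns (blockWindowMatrix m a b) (unitCompletion m A a) (a x.2) with hQ
  have hrow : ∀ z, Q x z = (1 : Matrix _ _ A) (x.1, (0 : Fin Nr)) z := by
    rintro ⟨p, t⟩
    by_cases ht : (t : ℕ) = 0
    · have ht' : (0 : Fin Nr) = t := Fin.ext (by simp [ht])
      simp [hQ, completedColumns, ← ht', unitCompletion, Matrix.one_apply]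
    · have ht' : (0 : Fin Nr) ≠ t := fun h => ht (by rw [← h]; simp)
      have := not_inWindow_cyclicShift hNr (a x.2) ht t.2
      rw [Matrix.one_apply_ne (by simp [ht']), hQ]
      simp only [completedColumns, Matrix.of_apply, if_neg ht, blockWindowMatrix, this, and_false,
        if_false]
  have h := congrFun (congrFun (Matrix.mul_adjugate Q) x) y
  rw [Matrix.mul_apply] at h
  simp only [hrow, Matrix.one_apply, ite_mul, one_mul, zero_mul, Finset.sum_ite_eq,
    Finset.mem_univ, if_true, Matrix.smul_apply, smul_eq_mul] at h
  rw [Matrix.diagonal_apply]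
  simpa [stackedAnnihilators, annihilator, ← hQ] using h

/-- Matching row `j` with column slot `j - i` is allowed by `inWindow_of_strictMono` and turns the
completed matrix into a permutation matrix. -/
theorem det_completedColumns_matching_ne_zero [NeZero Nr] (hNr : Nr ≤ N)
    {a : Fin Nr → Fin N} (ha : StrictMono a) (i : Fin Nr) :
    (completedColumns (blockWindowMatrix m a fun j r =>
      if r = cyclicShift (a i) (N - Nr + (j - i : Fin Nr)) then (1 : 𝔽) else 0)
      (unitCompletion m 𝔽 a) (a i)).det ≠ 0 := by
  have key : completedColumns (blockWindowMatrix m a fun j r =>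
      if r = cyclicShift (a i) (N - Nr + (j - i : Fin Nr)) then (1 : 𝔽) else 0)
      (unitCompletion m 𝔽 a) (a i) =
      (1 : Matrix _ _ 𝔽).submatrix
        ((Equiv.refl (Fin m)).prodCongr (Equiv.subRight i)) id := by
    ext ⟨p, j⟩ ⟨p', t⟩
    by_cases ht : (t : ℕ) = 0
    · have ht' : t = 0 := Fin.ext (by simp [ht])
      subst ht'
      simp [completedColumns, unitCompletion, Matrix.one_apply, sub_eq_zero, ha.injective.eq_iff]
    · have ht' : t ≠ 0 := fun h => ht (by rw [h]; simp)
      have hinj : cyclicShift (a i) (N - Nr + (t : ℕ)) =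
          cyclicShift (a i) (N - Nr + ((j - i : Fin Nr) : ℕ)) ↔ j - i = t := by
        rw [cyclicShift_inj (by omega) (by omega), Fin.ext_iff]
        omega
      have himp : j - i = t → InWindow Nr (a j) (cyclicShift (a i) (N - Nr + (t : ℕ))) := by
        rintro rfl
        refine inWindow_of_strictMono hNr ha i j fun hij => ht' (by simp [hij])
      simp only [completedColumns, Matrix.of_apply, if_neg ht, blockWindowMatrix, hinj,
        Matrix.submatrix_apply, Matrix.one_apply, id, Equiv.prodCongr_apply, Prod.map_apply,
        Equiv.refl_apply, Equiv.subRight_apply, Prod.mk.injEq]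
      by_cases hjt : j - i = t
      · simp [hjt, himp hjt]
      · simp [hjt]
  rw [key, Matrix.det_permute, Matrix.det_one, mul_one]
  rcases Int.units_eq_one_or (Equiv.Perm.sign ((Equiv.refl (Fin m)).prodCongr (Equiv.subRight i)))
    with h | h <;> rw [h] <;> simp

/-- Over some domain containing the field, the stacked annihilators are nonsingular at some
point. -/
theorem det_stackedAnnihilators_generic_ne_zero [NeZero Nr] (hNr : Nr ≤ N)
    {a : Fin Nr → Fin N} (ha : StrictMono a) :
    (stackedAnnihilators (blockWindowMatrix m a fun i r =>
      (MvPolynomial.X (i, r) : MvPolynomial (Fin Nr × Fin N) 𝔽))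
      (unitCompletion m _ a) a).det ≠ 0 := by
  rw [stackedAnnihilators_blockWindowMatrix hNr, Matrix.det_diagonal, Finset.prod_ne_zero_iff]
  intro x _ h0
  apply det_completedColumns_matching_ne_zero (𝔽 := 𝔽) (m := m) hNr ha x.2
  -- The matching depends on `x.2`, so no single point serves all factors; over the polynomial
  -- domain each factor may be specialized separately.
  have h := congrArg (MvPolynomial.eval fun v : Fin Nr × Fin N =>
    if v.2 = cyclicShift (a x.2) (N - Nr + (v.1 - x.2 : Fin Nr)) then (1 : 𝔽) else 0) h0
  rw [map_zero, RingHom.map_det, RingHom.mapMatrix_apply, completedColumns_map] at h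
  refine Eq.trans ?_ h
  congr 2
  · ext y k
    simp only [blockWindowMatrix, Matrix.of_apply, Matrix.map_apply]
    split_ifs <;> simp [*]
  · ext n y p
    simp only [unitCompletion, Matrix.of_apply, Matrix.map_apply]
    split_ifs <;> simp

end Witness

/-! ### Counting points at which an integral polynomial vanishes -/

theorem MvPolynomial.totalDegree_map_le_of_int {σ R : Type*} [CommRing R]
    (p : MvPolynomial σ ℤ) : (p.map (Int.castRingHom R)).totalDegree ≤ p.totalDegree :=
  Finset.sup_mono (MvPolynomial.support_map_subset _ _)

theorem MvPolynomial.card_zeros_mul_card_le {σ 𝔽 : Type*} [Finite σ] [Field 𝔽] [Finite 𝔽]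
    {p : MvPolynomial σ 𝔽} (hp : p ≠ 0) :
    Nat.card {f : σ → 𝔽 // MvPolynomial.eval f p = 0} * Nat.card 𝔽 ≤
      p.totalDegree * Nat.card (σ → 𝔽) := by
  classical
  cases nonempty_fintype σ
  cases nonempty_fintype 𝔽
  let e := Fintype.equivFin σ
  have hp' : MvPolynomial.rename e p ≠ 0 := by
    rwa [Ne, map_eq_zero_iff _ (MvPolynomial.rename_injective _ e.injective)]
  have h := MvPolynomial.schwartz_zippel_totalDegree hp' (Finset.univ : Finset 𝔽)
  rw [show (MvPolynomial.rename e p).totalDegree = p.totalDegree from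
    MvPolynomial.totalDegree_renameEquiv e p] at h
  have hc : (Finset.filter (fun f => MvPolynomial.eval f (MvPolynomial.rename e p) = 0)
      (Fintype.piFinset fun _ => (Finset.univ : Finset 𝔽))).card =
      Nat.card {f : σ → 𝔽 // MvPolynomial.eval f p = 0} := by
    rw [Nat.card_eq_fintype_card, Fintype.card_subtype]
    refine Finset.card_bij' (fun f _ => f ∘ e) (fun f _ => f ∘ e.symm) ?_ ?_ ?_ ?_
    · intro f hf
      simpa [MvPolynomial.eval_rename] using hf
    · intro f hf
      simpa [MvPolynomial.eval_rename, Function.comp_assoc] using hf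
    · intro f _; simp [Function.comp_assoc]
    · intro f _; simp [Function.comp_assoc]
  rw [hc] at h
  have hq : 0 < Fintype.card 𝔽 := Fintype.card_pos
  rw [Finset.card_univ, div_le_div_iff₀ (by positivity) (by positivity)] at h
  have h2 : Nat.card {f : σ → 𝔽 // MvPolynomial.eval f p = 0} * Fintype.card 𝔽 ≤
      p.totalDegree * Fintype.card 𝔽 ^ Fintype.card σ := by exact_mod_cast h
  simpa [Nat.card_eq_fintype_card] using h2

/-- Few points `f` are such that a nonzero polynomial vanishes at `(f, g)` for all `g`. -/
theorem MvPolynomial.card_forall_zero_mul_card_le {α β 𝔽 : Type*} [Finite α] [Finite β]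
    [Field 𝔽] [Finite 𝔽] {p : MvPolynomial (α ⊕ β) 𝔽} (hp : p ≠ 0) :
    Nat.card {f : α → 𝔽 // ∀ g : β → 𝔽, MvPolynomial.eval (Sum.elim f g) p = 0} * Nat.card 𝔽 ≤
      p.totalDegree * Nat.card (α → 𝔽) := by
  have h := MvPolynomial.card_zeros_mul_card_le hp
  -- Each such `f` contributes its whole fibre of zeros.
  have hle : Nat.card {f : α → 𝔽 // ∀ g : β → 𝔽, MvPolynomial.eval (Sum.elim f g) p = 0} *
      Nat.card (β → 𝔽) ≤ Nat.card {f : α ⊕ β → 𝔽 // MvPolynomial.eval f p = 0} := by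
    rw [← Nat.card_prod]
    refine Nat.card_le_card_of_injective (fun x => ⟨Sum.elim x.1.1 x.2, x.1.2 x.2⟩) ?_
    rintro ⟨⟨f, hf⟩, g⟩ ⟨⟨f', hf'⟩, g'⟩ h
    have h' : Sum.elim f g = Sum.elim f' g' := congrArg Subtype.val h
    have hf : f = f' := by
      funext i
      simpa using congrFun h' (Sum.inl i)
    have hg : g = g' := by
      funext i
      simpa using congrFun h' (Sum.inr i)
    subst hf hg
    rfl
  have hs : Nat.card (α ⊕ β → 𝔽) = Nat.card (α → 𝔽) * Nat.card (β → 𝔽) := by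
    rw [← Nat.card_prod, Nat.card_congr (Equiv.sumArrowEquivProdArrow α β 𝔽)]
  have hpos : 0 < Nat.card (β → 𝔽) := Nat.card_pos
  refine Nat.le_of_mul_le_mul_right ?_ hpos
  calc _ = Nat.card {f : α → 𝔽 // ∀ g : β → 𝔽, MvPolynomial.eval (Sum.elim f g) p = 0} *
          Nat.card (β → 𝔽) * Nat.card 𝔽 := by ring
    _ ≤ _ := Nat.mul_le_mul_right _ hle
    _ ≤ _ := h
    _ = _ := by rw [hs]; ring

/-- A finite family of integral polynomials, none of which vanishes modulo a prime, has few common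
bad points over every finite field. -/
theorem exists_forall_card_bad_le {ι α β : Type*} [Finite ι] [Finite α] [Finite β]
    (p : ι → MvPolynomial (α ⊕ β) ℤ)
    (hp : ∀ (𝔽 : Type) [Field 𝔽], ∀ i, (p i).map (Int.castRingHom 𝔽) ≠ 0) :
    ∃ d : ℕ, ∀ (𝔽 : Type) [Field 𝔽] [Finite 𝔽],
      Nat.card {f : α → 𝔽 // ¬ ∃ g : β → 𝔽, ∀ i, MvPolynomial.aeval (Sum.elim f g) (p i) ≠ 0} *
        Nat.card 𝔽 ≤ d * Nat.card (α → 𝔽) := by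
  cases nonempty_fintype ι
  -- The degree is taken over `ℤ`, hence is uniform in the field.
  refine ⟨(∏ i, p i).totalDegree, fun 𝔽 _ _ => ?_⟩
  have hP : (∏ i, p i).map (Int.castRingHom 𝔽) ≠ 0 := by
    rw [map_prod, Finset.prod_ne_zero_iff]
    exact fun i _ => hp 𝔽 i
  refine le_trans (le_trans (Nat.mul_le_mul_right _ ?_)
    (MvPolynomial.card_forall_zero_mul_card_le hP))
    (Nat.mul_le_mul_right _ (MvPolynomial.totalDegree_map_le_of_int _))
  refine Nat.card_le_card_of_injective (fun f => ⟨f.1, fun g => ?_⟩) ?_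
  · have hf := f.2
    push Not at hf
    obtain ⟨i, hi⟩ := hf g
    rw [map_prod, map_prod]
    refine Finset.prod_eq_zero (Finset.mem_univ i) ?_
    rw [MvPolynomial.eval_map]
    exact hi
  · intro f f' h
    exact Subtype.ext (by simpa using h)

/-- Allowing values in an `𝔽`-algebra lets a generic point over a polynomial ring certify
nonvanishing even when `𝔽` is small. -/
theorem map_intCast_ne_zero_of_aeval_ne_zero {σ 𝔽 B : Type*} [Field 𝔽] [CommRing B] [Algebra 𝔽 B]
    (p : MvPolynomial σ ℤ) (x : σ → B) (h : MvPolynomial.aeval x p ≠ 0) :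
    p.map (Int.castRingHom 𝔽) ≠ 0 := by
  intro h0
  apply h
  have := congrArg (MvPolynomial.aeval (R := 𝔽) x) h0
  rw [map_zero, ← algebraMap_int_eq, MvPolynomial.aeval_map_algebraMap] at this
  exact this

/-! ### Schemes from encoding functions -/

section Scheme

variable {K N Nr Kc M L : ℕ}

/-- For the request matrix `F`, there are encoding functions with outputs indexed by `τ`, which only
use the messages assigned by `Z`, such that any `Nr` encoded messages determine the requested
product. -/
def IsServable {𝔽 : Type} [Field 𝔽] (Nr : ℕ) (Z : Fin N → Finset (Fin K)) (τ : Type)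
    (F : Matrix (Fin Kc) (Fin K) 𝔽) (L : ℕ) : Prop :=
  ∃ e : Fin N → Matrix (Fin K) (Fin L) 𝔽 → τ → 𝔽,
    (∀ n W W', (∀ k ∈ Z n, W k = W' k) → e n W = e n W') ∧
    ∀ A : Finset (Fin N), A.card = Nr → ∀ W W', (∀ n ∈ A, e n W = e n W') → F * W = F * W'

/-- The master may decode with any `W` consistent with the answers, since they determine `F * W`. -/
theorem exists_scheme_of_isServable {𝔽 : Type} [Field 𝔽] {Z : Fin N → Finset (Fin K)}
    (hZ : ∀ n, (Z n).card ≤ M) (t : ℕ) :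
    ∃ S : Scheme 𝔽 K N Nr Kc M L, (∀ F n, S.assign F n = Z n) ∧ (∀ n, S.T n = t) ∧
      ∀ F, IsServable Nr Z (Fin t) F L → ∀ A W, S.output A F W = F * W := by
  classical
  have h : ∀ F : Matrix (Fin Kc) (Fin K) 𝔽, ∃ e : Fin N → Matrix (Fin K) (Fin L) 𝔽 → Fin t → 𝔽,
      IsServable Nr Z (Fin t) F L → (∀ n W W', (∀ k ∈ Z n, W k = W' k) → e n W = e n W') ∧
        ∀ A : Finset (Fin N), A.card = Nr → ∀ W W', (∀ n ∈ A, e n W = e n W') →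
          F * W = F * W' := by
    intro F
    by_cases hF : IsServable Nr Z (Fin t) F L
    · obtain ⟨e, he⟩ := hF
      exact ⟨e, fun _ => he⟩
    · exact ⟨fun _ _ => 0, fun h => absurd h hF⟩
  choose e he using h
  let S : Scheme 𝔽 K N Nr Kc M L :=
    { assign := fun _ n => Z n
      card_assign_le := fun _ n => hZ n
      T := fun _ => t
      -- Missing messages are set to zero, which is harmless because `e F n` ignores them when `F`
      -- is servable.
      encode := fun n F w => e F n fun k => if hk : k ∈ Z n then w ⟨k, hk⟩ else 0
      decode := fun A y F =>
        if h : ∃ W : Matrix (Fin K) (Fin L) 𝔽, ∀ n : A.1, e F n.1 W = y n then F * h.choose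
        else 0 }
  refine ⟨S, fun _ _ => rfl, fun _ => rfl, fun F hF A W => ?_⟩
  obtain ⟨h1, h2⟩ := he F hF
  have henc : ∀ n, (e F n fun k => if k ∈ Z n then W k else 0) = e F n W :=
    fun n => h1 n _ _ fun k hk => by simp [hk]
  have hex : ∃ W' : Matrix (Fin K) (Fin L) 𝔽, ∀ n : A.1, e F n.1 W' =
      e F n.1 fun k => if k ∈ Z n.1 then W k else 0 := ⟨W, fun n => (henc n).symm⟩
  have hout : S.output A F W = F * hex.choose := by
    simp only [Scheme.output, S]
    exact dif_pos hex
  rw [hout]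
  exact h2 A.1 A.2 _ _ fun n hn => (hex.choose_spec ⟨n, hn⟩).trans (henc n)

theorem Scheme.commCost_eq_of_forall_T_eq {𝔽 : Type} [Field 𝔽] (hNr : Nr ≤ N)
    (S : Scheme 𝔽 K N Nr Kc M L) {t : ℕ} (hT : ∀ n, S.T n = t) :
    S.commCost = (Nr : ℝ) * t / L := by
  obtain ⟨A, -, hA⟩ := Finset.exists_subset_card_eq (s := (Finset.univ : Finset (Fin N)))
    (n := Nr) (by simpa using hNr)
  have : Nonempty {A : Finset (Fin N) // A.card = Nr} := ⟨⟨A, hA⟩⟩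
  have : ∀ A : {A : Finset (Fin N) // A.card = Nr},
      (∑ n ∈ A.1, (S.T n : ℝ)) / (L : ℝ) = (Nr : ℝ) * t / L := by
    intro A
    simp [hT, A.2]
  rw [Scheme.commCost, iSup_congr this, ciSup_const]

theorem Scheme.errorProb_le {𝔽 : Type} [Field 𝔽] [Finite 𝔽]
    (S : Scheme 𝔽 K N Nr Kc M L) (P : Matrix (Fin Kc) (Fin K) 𝔽 → Prop)
    (hP : ∀ F, P F → ∀ A W, S.output A F W = F * W) {d : ℕ}
    (hd : Nat.card {F // ¬ P F} * Nat.card 𝔽 ≤ d * Nat.card (Matrix (Fin Kc) (Fin K) 𝔽)) :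
    S.errorProb ≤ d / Nat.card 𝔽 := by
  have : Finite (Matrix (Fin Kc) (Fin K) 𝔽) := inferInstanceAs (Finite (_ → _ → 𝔽))
  have : Finite (Matrix (Fin K) (Fin L) 𝔽) := inferInstanceAs (Finite (_ → _ → 𝔽))
  refine Real.iSup_le (fun A => ?_) (by positivity)
  have hq : (0 : ℝ) < Nat.card 𝔽 := by exact_mod_cast Nat.card_pos
  have hFW : (0 : ℝ) < Nat.card (Matrix (Fin Kc) (Fin K) 𝔽 × Matrix (Fin K) (Fin L) 𝔽) := by
    exact_mod_cast Nat.card_pos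
  rw [Scheme.errorProbAt, div_le_div_iff₀ hFW hq]
  have hle : Nat.card {p : Matrix (Fin Kc) (Fin K) 𝔽 × Matrix (Fin K) (Fin L) 𝔽 //
      S.output A p.1 p.2 ≠ p.1 * p.2} ≤ Nat.card {F // ¬ P F} *
        Nat.card (Matrix (Fin K) (Fin L) 𝔽) := by
    rw [← Nat.card_prod]
    refine Nat.card_le_card_of_injective
      (fun p => (⟨p.1.1, fun h => p.2 (hP _ h A _)⟩, p.1.2)) ?_
    intro p p' h
    simp only [Prod.mk.injEq, Subtype.mk.injEq] at h
    exact Subtype.ext (Prod.ext h.1 h.2)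
  have : Nat.card {p : Matrix (Fin Kc) (Fin K) 𝔽 × Matrix (Fin K) (Fin L) 𝔽 //
      S.output A p.1 p.2 ≠ p.1 * p.2} * Nat.card 𝔽 ≤
      d * Nat.card (Matrix (Fin Kc) (Fin K) 𝔽 × Matrix (Fin K) (Fin L) 𝔽) := by
    rw [Nat.card_prod]
    calc _ ≤ _ := Nat.mul_le_mul_right _ hle
      _ = Nat.card {F // ¬ P F} * Nat.card 𝔽 * Nat.card (Matrix (Fin K) (Fin L) 𝔽) := by ring
      _ ≤ _ := Nat.mul_le_mul_right _ hd
      _ = _ := by ring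
  exact_mod_cast this

/-- If all but a fraction `O(1 / q)` of the request matrices can be served, then the corresponding
communication cost is achievable. -/
theorem isAchievableWith_of_isServable (hNr : Nr ≤ N) {Z : Fin N → Finset (Fin K)}
    (hZ : ∀ n, (Z n).card ≤ M) (τ : Type) [Fintype τ] {R : ℝ}
    (hR : (Nr : ℝ) * Fintype.card τ / L = R)
    (q₀ d : ℕ) (hd : ∀ (𝔽 : Type) [Field 𝔽] [Finite 𝔽], q₀ ≤ Nat.card 𝔽 →
      Nat.card {F : Matrix (Fin Kc) (Fin K) 𝔽 // ¬ IsServable Nr Z τ F L} * Nat.card 𝔽 ≤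
        d * Nat.card (Matrix (Fin Kc) (Fin K) 𝔽)) :
    IsAchievableWith K N Nr Kc M L Z R := by
  have hτ : ∀ (𝔽 : Type) [Field 𝔽] (F : Matrix (Fin Kc) (Fin K) 𝔽), IsServable Nr Z τ F L →
      IsServable Nr Z (Fin (Fintype.card τ)) F L := by
    rintro 𝔽 _ F ⟨e, h1, h2⟩
    let f := Fintype.equivFin τ
    refine ⟨fun n W => e n W ∘ f.symm, fun n W W' h => congrArg (· ∘ f.symm) (h1 n W W' h),
      fun A hA W W' h => h2 A hA W W' fun n hn => ?_⟩
    exact f.symm.surjective.injective_comp_right (h n hn)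
  choose S hS using fun (𝔽 : Type) (inst : Field 𝔽) (_ : Finite 𝔽) =>
    exists_scheme_of_isServable (𝔽 := 𝔽) (Nr := Nr) (Kc := Kc) (M := M) (L := L) hZ
      (Fintype.card τ)
  refine ⟨fun 𝔽 inst fin => S 𝔽 inst fin, fun 𝔽 inst fin => ⟨(hS 𝔽 inst fin).1, ?_⟩, ?_⟩
  · rw [Scheme.commCost_eq_of_forall_T_eq hNr _ (hS 𝔽 inst fin).2.1, hR]
  · intro ε hε
    obtain ⟨q₁, hq₁⟩ := exists_nat_gt (d / ε)
    refine ⟨max q₀ q₁, fun 𝔽 inst fin hq => ?_⟩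
    refine (Scheme.errorProb_le _ (fun F => IsServable Nr Z τ F L)
      (fun F hF => (hS 𝔽 inst fin).2.2 F (hτ 𝔽 F hF)) (hd 𝔽 (le_trans (le_max_left _ _) hq))).trans ?_
    have hq0 : (0 : ℝ) < Nat.card 𝔽 := by exact_mod_cast Nat.card_pos
    have : (q₁ : ℝ) ≤ Nat.card 𝔽 := by exact_mod_cast le_trans (le_max_right _ _) hq
    rw [div_le_iff₀ hq0]
    rw [div_lt_iff₀ hε] at hq₁
    nlinarith

end Scheme

/-! ### The cyclic assignment -/

theorem mem_cyclicAssignment {m N Nr : ℕ} {n : Fin N} {p : Fin m} {r : Fin N}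
    (h : InWindow Nr n r) :
    finProdFinEquiv (p, r) ∈ cyclicAssignment (m * N) N Nr n := by
  obtain ⟨j, hj, rfl⟩ := h
  have hm : m * N / N = m := Nat.mul_div_cancel _ n.pos
  simp only [cyclicAssignment, Finset.mem_filter, Finset.mem_univ, true_and]
  refine ⟨⟨p, by rw [hm]; exact p.2⟩, ⟨j, by omega⟩, ?_⟩
  simp [finProdFinEquiv, cyclicShift, mul_comm]

theorem card_cyclicAssignment_le {K N Nr : ℕ} (n : Fin N) :
    (cyclicAssignment K N Nr n).card ≤ K / N * (N - Nr + 1) := by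
  classical
  have h : ∀ k : cyclicAssignment K N Nr n, ∃ x : Fin (K / N) × Fin (N - Nr + 1),
      (k : ℕ) = ((n : ℕ) + (x.2 : ℕ)) % N + (x.1 : ℕ) * N := by
    intro k
    obtain ⟨p, j, hpj⟩ := (Finset.mem_filter.mp k.2).2
    exact ⟨(p, j), hpj⟩
  choose f hf using h
  have hinj : Function.Injective f := by
    intro k k' h
    have h1 := hf k
    rw [h, ← hf k'] at h1
    exact Subtype.ext (Fin.ext h1)
  simpa using Fintype.card_le_of_injective f hinj

/-! ### Generic codes -/

section GenericCode

variable {m N Nr : ℕ} [NeZero Nr]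

/-- The determinant of the stacked annihilators as a polynomial in the entries of the two matrices,
which are variables named by `u`. -/
noncomputable def stackedDetPolynomial {σ : Type*}
    (u : (Fin m × Fin Nr) × (Fin m × Fin N) ⊕ Fin N × (Fin m × Fin Nr) × Fin m → σ)
    (a : Fin Nr → Fin N) : MvPolynomial σ ℤ :=
  (stackedAnnihilators (Matrix.of fun x k => MvPolynomial.X (u (Sum.inl (x, k))))
    (fun n => Matrix.of fun x p => MvPolynomial.X (u (Sum.inr (n, x, p)))) a).det

theorem aeval_stackedDetPolynomial {σ B : Type*} [CommRing B]
    (u : (Fin m × Fin Nr) × (Fin m × Fin N) ⊕ Fin N × (Fin m × Fin Nr) × Fin m → σ)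
    (a : Fin Nr → Fin N) (y : σ → B) :
    MvPolynomial.aeval y (stackedDetPolynomial u a) =
      (stackedAnnihilators (Matrix.of fun x k => y (u (Sum.inl (x, k))))
        (fun n => Matrix.of fun x p => y (u (Sum.inr (n, x, p)))) a).det := by
  have h := map_det_stackedAnnihilators (MvPolynomial.aeval (R := ℤ) y).toRingHom
    (Matrix.of fun x k => MvPolynomial.X (u (Sum.inl (x, k))))
    (fun n => Matrix.of fun x p => MvPolynomial.X (u (Sum.inr (n, x, p)))) a
  refine Eq.trans h ?_
  congr 2
  · ext x k
    simp
  · ext n x p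
    simp

theorem map_stackedDetPolynomial_ne_zero {σ : Type*} (hNr : Nr ≤ N)
    {u : (Fin m × Fin Nr) × (Fin m × Fin N) ⊕ Fin N × (Fin m × Fin Nr) × Fin m → σ}
    (hu : Function.Injective u) {a : Fin Nr → Fin N} (ha : StrictMono a)
    (𝔽 : Type*) [Field 𝔽] :
    (stackedDetPolynomial u a).map (Int.castRingHom 𝔽) ≠ 0 := by
  let B := MvPolynomial (Fin Nr × Fin N) 𝔽
  let y₀ : (Fin m × Fin Nr) × (Fin m × Fin N) ⊕ Fin N × (Fin m × Fin Nr) × Fin m → B :=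
    Sum.elim
      (fun z => blockWindowMatrix m a (fun i r => (MvPolynomial.X (i, r) : B)) z.1 z.2)
      (fun z => unitCompletion m B a z.1 z.2.1 z.2.2)
  -- Injectivity of `u` allows the witness values to be prescribed freely; variables outside its
  -- range get `0`.
  refine map_intCast_ne_zero_of_aeval_ne_zero (B := B) _ (Function.extend u y₀ 0) ?_
  rw [aeval_stackedDetPolynomial]
  simp only [hu.extend_apply, y₀, Sum.elim_inl, Sum.elim_inr]
  exact det_stackedAnnihilators_generic_ne_zero hNr ha

end GenericCode

/-! ### Locality of the encoding and recovery from `Nr` workers -/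

section Decoding

variable {m N Nr : ℕ} [NeZero Nr] {𝔽 l : Type*} [Field 𝔽]
  {G : Matrix (Fin m × Fin Nr) (Fin m × Fin N) 𝔽}
  {C : Fin N → Matrix (Fin m × Fin Nr) (Fin m) 𝔽}

theorem annihilator_mul_mul_congr (hNr : Nr ≤ N) {n : Fin N}
    {V V' : Matrix (Fin m × Fin N) l 𝔽} (h : ∀ k, InWindow Nr n k.2 → V k = V' k) :
    annihilator G C n * (G * V) = annihilator G C n * (G * V') := by
  rw [← Matrix.mul_assoc, ← Matrix.mul_assoc]
  ext p c
  rw [Matrix.mul_apply, Matrix.mul_apply]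
  refine Finset.sum_congr rfl fun k _ => ?_
  by_cases hk : InWindow Nr n k.2
  · rw [h k hk]
  · rw [annihilator_mul_apply_eq_zero hNr G C p hk, zero_mul, zero_mul]

theorem mul_eq_mul_of_annihilator_mul_eq
    (hdet : ∀ a : Fin Nr → Fin N, StrictMono a → (stackedAnnihilators G C a).det ≠ 0)
    {A : Finset (Fin N)} (hA : A.card = Nr) {V V' : Matrix (Fin m × Fin N) l 𝔽}
    (h : ∀ n ∈ A, annihilator G C n * (G * V) = annihilator G C n * (G * V')) :
    G * V = G * V' := by
  rw [← sub_eq_zero]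
  refine eq_zero_of_annihilator_mul_eq_zero G C (A.orderEmbOfFin hA)
    (hdet _ (A.orderEmbOfFin hA).strictMono) _ fun i => ?_
  rw [Matrix.mul_sub, h _ (A.orderEmbOfFin_mem hA i), sub_self]

end Decoding

/-- The variables `β` are code coefficients that may be chosen after seeing `F`; only an `F` with no
good choice counts as bad. -/
theorem isAchievableWith_of_polynomials {K N Nr Kc M L : ℕ} (hNr : Nr ≤ N)
    {Z : Fin N → Finset (Fin K)} (hZ : ∀ n, (Z n).card ≤ M) (τ : Type) [Fintype τ] {R : ℝ}
    (hR : (Nr : ℝ) * Fintype.card τ / L = R) {ι β : Type*} [Finite ι] [Finite β]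
    (p : ι → MvPolynomial (Fin Kc × Fin K ⊕ β) ℤ)
    (hp : ∀ (𝔽 : Type) [Field 𝔽], ∀ i, (p i).map (Int.castRingHom 𝔽) ≠ 0) (q₀ : ℕ)
    (hs : ∀ (𝔽 : Type) [Field 𝔽] [Finite 𝔽], q₀ ≤ Nat.card 𝔽 →
      ∀ (F : Matrix (Fin Kc) (Fin K) 𝔽) (g : β → 𝔽),
        (∀ i, MvPolynomial.aeval (Sum.elim (fun v => F v.1 v.2) g) (p i) ≠ 0) →
          IsServable Nr Z τ F L) :
    IsAchievableWith K N Nr Kc M L Z R := by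
  obtain ⟨d, hd⟩ := exists_forall_card_bad_le p hp
  refine isAchievableWith_of_isServable hNr hZ τ hR q₀ d fun 𝔽 _ _ hq => ?_
  have hcard : Nat.card (Matrix (Fin Kc) (Fin K) 𝔽) = Nat.card (Fin Kc × Fin K → 𝔽) :=
    Nat.card_congr (Equiv.curry (Fin Kc) (Fin K) 𝔽).symm
  rw [hcard]
  refine le_trans (Nat.mul_le_mul_right _ ?_) (hd 𝔽)
  refine Nat.card_le_card_of_injective
    (fun F => ⟨fun v => F.1 v.1 v.2, fun ⟨g, hg⟩ => F.2 (hs 𝔽 hq F.1 g hg)⟩) ?_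
  intro F F' h
  have h' : (fun v : Fin Kc × Fin K => F.1 v.1 v.2) = fun v => F'.1 v.1 v.2 :=
    congrArg Subtype.val h
  exact Subtype.ext (Matrix.ext fun i k => congrFun h' (i, k))

/-! ### The three regimes -/

section Regimes

variable {m N Nr Kc M L : ℕ}

/-- Messages regrouped by quotient and residue of their index modulo `N`. -/
def regroup {𝔽 l : Type*} (W : Matrix (Fin (m * N)) l 𝔽) : Matrix (Fin m × Fin N) l 𝔽 :=
  W.submatrix finProdFinEquiv id

theorem regroup_apply_congr {𝔽 l : Type*} {n : Fin N} {W W' : Matrix (Fin (m * N)) l 𝔽}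
    (h : ∀ k ∈ cyclicAssignment (m * N) N Nr n, W k = W' k) (k : Fin m × Fin N)
    (hk : InWindow Nr n k.2) : regroup W k = regroup W' k :=
  h _ (mem_cyclicAssignment hk)

theorem mul_apply_eq_sum_regroup {𝔽 l κ : Type*} [Field 𝔽] (F : Matrix κ (Fin (m * N)) 𝔽)
    (W : Matrix (Fin (m * N)) l 𝔽) (i : κ) (c : l) :
    (F * W) i c = ∑ k, F i (finProdFinEquiv k) * regroup W k c := by
  rw [Matrix.mul_apply, ← finProdFinEquiv.sum_comp]
  rfl

theorem isAchievableWith_of_le_mul [NeZero Nr] (hNr : Nr ≤ N) (hL : 1 ≤ L) (hM : M = m * (N - Nr + 1))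
    (hKc : Kc ≤ m * Nr) :
    IsAchievableWith (m * N) N Nr Kc M L (cyclicAssignment (m * N) N Nr) ((m : ℝ) * Nr) := by
  have hN : 0 < N := lt_of_lt_of_le (NeZero.pos Nr) hNr
  have hZ : ∀ n, (cyclicAssignment (m * N) N Nr n).card ≤ M := fun n => by
    simpa [hM, Nat.mul_div_cancel _ hN] using card_cyclicAssignment_le (K := m * N) (Nr := Nr) n
  -- The first `Kc` rows of `G` are those of `F`; the padding rows and the completions are free
  -- variables.
  let u : (Fin m × Fin Nr) × (Fin m × Fin N) ⊕ Fin N × (Fin m × Fin Nr) × Fin m →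
      Fin Kc × Fin (m * N) ⊕
        ((Fin m × Fin Nr) × (Fin m × Fin N) ⊕ Fin N × (Fin m × Fin Nr) × Fin m) :=
    Sum.elim (fun z => if h : (finProdFinEquiv z.1 : ℕ) < Kc then
      Sum.inl (⟨finProdFinEquiv z.1, h⟩, finProdFinEquiv z.2) else Sum.inr (Sum.inl z))
      (fun z => Sum.inr (Sum.inr z))
  have hu : Function.Injective u := by
    rintro (⟨x, k⟩ | z) (⟨x', k'⟩ | z') h
    · simp only [u, Sum.elim_inl] at h
      split_ifs at h with h1 h2 h2
      · simp only [Sum.inl.injEq, Prod.mk.injEq, Fin.mk.injEq, Fin.val_inj,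
          EmbeddingLike.apply_eq_iff_eq] at h
        rw [h.1, h.2]
      · simpa using h
    · simp only [u, Sum.elim_inl, Sum.elim_inr] at h
      split_ifs at h
      simp at h
    · simp only [u, Sum.elim_inl, Sum.elim_inr] at h
      split_ifs at h
      simp at h
    · simpa [u] using h
  refine isAchievableWith_of_polynomials hNr hZ (Fin m × Fin L) ?_
    (fun a : {a : Fin Nr → Fin N // StrictMono a} => stackedDetPolynomial u a.1)
    (fun 𝔽 _ a => map_stackedDetPolynomial_ne_zero hNr hu a.2 𝔽) 0 ?_
  · have : (L : ℝ) ≠ 0 := by positivity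
    simp only [Fintype.card_prod, Fintype.card_fin]
    push_cast
    field_simp
  · intro 𝔽 _ _ _ F g hg
    simp only [aeval_stackedDetPolynomial] at hg
    set y := Sum.elim (fun v : Fin Kc × Fin (m * N) => F v.1 v.2) g with hy
    set G : Matrix (Fin m × Fin Nr) (Fin m × Fin N) 𝔽 :=
      Matrix.of fun x k => y (u (Sum.inl (x, k))) with hG
    set C : Fin N → Matrix (Fin m × Fin Nr) (Fin m) 𝔽 :=
      fun n => Matrix.of fun x p => y (u (Sum.inr (n, x, p)))
    have hGF : ∀ (i : Fin Kc) k, G (finProdFinEquiv.symm (Fin.castLE hKc i)) k =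
        F i (finProdFinEquiv k) := by
      intro i k
      simp only [hG, Matrix.of_apply, u, Sum.elim_inl, Equiv.apply_symm_apply]
      rw [dif_pos (by simp)]
      rfl
    refine ⟨fun n W z => (annihilator G C n * (G * regroup W)) z.1 z.2, ?_, ?_⟩
    · intro n W W' h
      funext z
      dsimp only
      rw [annihilator_mul_mul_congr hNr (regroup_apply_congr h)]
    · intro A hA W W' h
      have h1 : G * regroup W = G * regroup W' :=
        mul_eq_mul_of_annihilator_mul_eq (G := G) (C := C) (fun a ha => hg ⟨a, ha⟩) hA fun n hn => by
          ext p c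
          exact congrFun (h n hn) (p, c)
      ext i c
      have h2 := congrFun (congrFun h1 (finProdFinEquiv.symm (Fin.castLE hKc i))) c
      rw [Matrix.mul_apply, Matrix.mul_apply] at h2
      simpa only [mul_apply_eq_sum_regroup, hGF] using h2

theorem isAchievableWith_mul [NeZero Nr] (hNr : Nr ≤ N) (hL : 1 ≤ L) (hM : M = m * (N - Nr + 1)) :
    IsAchievableWith (m * N) N Nr Kc M L (cyclicAssignment (m * N) N Nr) ((Nr : ℝ) * Kc) := by
  have hN : 0 < N := lt_of_lt_of_le (NeZero.pos Nr) hNr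
  have hZ : ∀ n, (cyclicAssignment (m * N) N Nr n).card ≤ M := fun n => by
    simpa [hM, Nat.mul_div_cancel _ hN] using card_cyclicAssignment_le (K := m * N) (Nr := Nr) n
  refine isAchievableWith_of_polynomials hNr hZ (Fin Kc × Fin 1 × Fin L) ?_
    (ι := {a : Fin Nr → Fin N // StrictMono a} ⊕ Fin N)
    (β := (Fin 1 × Fin Nr) × (Fin 1 × Fin N) ⊕ Fin N × (Fin 1 × Fin Nr) × Fin 1)
    (Sum.elim (fun a => stackedDetPolynomial Sum.inr a.1)
      (fun r => MvPolynomial.X (Sum.inr (Sum.inl ((0, 0), (0, r)))))) ?_ 0 ?_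
  · have : (L : ℝ) ≠ 0 := by positivity
    simp only [Fintype.card_prod, Fintype.card_fin]
    push_cast
    field_simp
  · rintro 𝔽 _ (a | r)
    · exact map_stackedDetPolynomial_ne_zero hNr Sum.inr_injective a.2 𝔽
    · simp [MvPolynomial.X_ne_zero]
  · intro 𝔽 _ _ _ F g hg
    have hdet := fun a => hg (Sum.inl a)
    have hg0 := fun r => hg (Sum.inr r)
    simp only [Sum.elim_inl, Sum.elim_inr, aeval_stackedDetPolynomial, MvPolynomial.aeval_X]
      at hdet hg0
    set G : Matrix (Fin 1 × Fin Nr) (Fin 1 × Fin N) 𝔽 :=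
      Matrix.of fun x k => g (Sum.inl (x, k)) with hG
    set C : Fin N → Matrix (Fin 1 × Fin Nr) (Fin 1) 𝔽 :=
      fun n => Matrix.of fun x p => g (Sum.inr (n, x, p))
    -- Dividing by the first row of `G` makes the first row of `G * V i W` the `i`-th requested
    -- combination, while `G` stays independent of `F`.
    let V : Fin Kc → Matrix (Fin (m * N)) (Fin L) 𝔽 → Matrix (Fin 1 × Fin N) (Fin L) 𝔽 :=
      fun i W => Matrix.of fun k c => (G (0, 0) (0, k.2))⁻¹ *
        ∑ p, F i (finProdFinEquiv (p, k.2)) * regroup W (p, k.2) c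
    have hGV : ∀ i W c, (G * V i W) (0, 0) c = (F * W) i c := by
      intro i W c
      rw [mul_apply_eq_sum_regroup, Matrix.mul_apply, Fintype.sum_prod_type,
        Fintype.sum_prod_type_right, Fintype.sum_unique]
      refine Finset.sum_congr rfl fun r _ => ?_
      exact mul_inv_cancel_left₀ (hg0 r) _
    refine ⟨fun n W z => (annihilator G C n * (G * V z.1 W)) z.2.1 z.2.2, ?_, ?_⟩
    · intro n W W' h
      funext z
      dsimp only
      rw [annihilator_mul_mul_congr hNr (V' := V z.1 W')]
      intro k hk
      funext c
      simp only [V, Matrix.of_apply]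
      congr 1
      refine Finset.sum_congr rfl fun p _ => ?_
      rw [regroup_apply_congr h (p, k.2) hk]
    · intro A hA W W' h
      ext i c
      have h1 : G * V i W = G * V i W' :=
        mul_eq_mul_of_annihilator_mul_eq (C := C) (fun a ha => hdet ⟨a, ha⟩) hA fun n hn => by
          ext p c
          exact congrFun (h n hn) (i, p, c)
      rw [← hGV, ← hGV, h1]

theorem card_filter_mem_powersetCard {α : Type*} [Fintype α] [DecidableEq α] (i : α) {k : ℕ}
    (hk : 1 ≤ k) :
    ((Finset.powersetCard k (Finset.univ : Finset α)).filter fun s => i ∈ s).card =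
      (Fintype.card α - 1).choose (k - 1) := by
  rw [← Finset.card_univ, ← Finset.card_erase_of_mem (Finset.mem_univ i),
    ← Finset.card_powersetCard]
  refine Finset.card_bij' (fun s _ => s.erase i) (fun s _ => insert i s) ?_ ?_ ?_ ?_
  · intro s hs
    simp only [Finset.mem_filter, Finset.mem_powersetCard] at hs ⊢
    exact ⟨Finset.erase_subset_erase _ hs.1.1, by rw [Finset.card_erase_of_mem hs.2, hs.1.2]⟩
  · intro s hs
    simp only [Finset.mem_filter, Finset.mem_powersetCard] at hs ⊢
    have hi : i ∉ s := fun h => by simpa using hs.1 h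
    refine ⟨⟨Finset.subset_univ _, ?_⟩, Finset.mem_insert_self _ _⟩
    rw [Finset.card_insert_of_notMem hi, hs.2]
    omega
  · intro s hs
    exact Finset.insert_erase (Finset.mem_filter.mp hs).2
  · intro s hs
    have hi : i ∉ s := fun h => by simpa using (Finset.mem_powersetCard.mp hs).1 h
    exact Finset.erase_insert hi

/-- A vector orthogonal to the power sequences of sufficiently many distinct scalars vanishes. -/
theorem eq_zero_of_forall_mem_sum_pow_mul_eq_zero {𝔽 : Type*} [Field 𝔽] {D : ℕ} {ι : Type*}
    {x : ι → 𝔽} (hx : Function.Injective x) {s : Finset ι} (hs : s.card = D) {v : Fin D → 𝔽}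
    (h : ∀ j ∈ s, ∑ d : Fin D, x j ^ (d : ℕ) * v d = 0) : v = 0 := by
  let f := (s.equivFinOfCardEq hs).symm
  refine Matrix.eq_zero_of_forall_index_sum_pow_mul_eq_zero (f := fun j => x (f j))
    (hx.comp (Subtype.val_injective.comp f.injective)) fun j => h _ (f j).2

theorem isAchievableWith_of_mul_lt [NeZero Nr] (hNr : Nr ≤ N) (hm : 0 < m) (hL : 1 ≤ L)
    (hM : M = m * (N - Nr + 1)) (hKc : m * Nr < Kc)
    (hdvd : (Kc - 1).choose (m * Nr - 1) ∣ L) :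
    IsAchievableWith (m * N) N Nr Kc M L (cyclicAssignment (m * N) N Nr) (Kc : ℝ) := by
  have hN : 0 < N := lt_of_lt_of_le (NeZero.pos Nr) hNr
  have hZ : ∀ n, (cyclicAssignment (m * N) N Nr n).card ≤ M := fun n => by
    simpa [hM, Nat.mul_div_cancel _ hN] using card_cyclicAssignment_le (K := m * N) (Nr := Nr) n
  have hk : 1 ≤ m * Nr := Nat.mul_pos hm (NeZero.pos Nr)
  set D := (Kc - 1).choose (m * Nr - 1) with hD
  obtain ⟨L', rfl⟩ := hdvd
  have hD0 : 0 < D := Nat.pos_of_mul_pos_right hL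
  have hL0 : 0 < L' := Nat.pos_of_mul_pos_left hL
  let J := {s : Finset (Fin Kc) // s ∈ Finset.powersetCard (m * Nr) Finset.univ}
  have hJ : ∀ s : J, s.1.card = m * Nr := fun s => (Finset.mem_powersetCard.mp s.2).2
  have hcJ : Fintype.card J = Kc.choose (m * Nr) := by
    simp [J]
  let u : J → (Fin m × Fin Nr) × (Fin m × Fin N) ⊕ Fin N × (Fin m × Fin Nr) × Fin m →
      Fin Kc × Fin (m * N) ⊕ Fin N × (Fin m × Fin Nr) × Fin m := fun s =>
    Sum.map (Prod.map (fun x => s.1.orderEmbOfFin (hJ s) (finProdFinEquiv x)) finProdFinEquiv) id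
  have hu : ∀ s, Function.Injective (u s) := fun s =>
    Function.Injective.sumMap (Function.Injective.prodMap
      ((s.1.orderEmbOfFin (hJ s)).injective.comp finProdFinEquiv.injective)
      finProdFinEquiv.injective) Function.injective_id
  refine isAchievableWith_of_polynomials hNr hZ (J × Fin m × Fin L') ?_
    (fun a : J × {a : Fin Nr → Fin N // StrictMono a} => stackedDetPolynomial (u a.1) a.2.1)
    (fun 𝔽 _ a => map_stackedDetPolynomial_ne_zero hNr (hu a.1) a.2.2 𝔽) (Fintype.card J) ?_
  · have hL0' : (L' : ℝ) ≠ 0 := by positivity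
    have hD0' : (D : ℝ) ≠ 0 := by positivity
    -- Double counting pairs of a row and a set containing it; this turns the cost into `Kc`.
    have hch : Kc * D = Kc.choose (m * Nr) * (m * Nr) := by
      have := Nat.add_one_mul_choose_eq (Kc - 1) (m * Nr - 1)
      rwa [Nat.sub_add_cancel hk, Nat.sub_add_cancel (by omega)] at this
    have hch' : (Kc : ℝ) * D = Kc.choose (m * Nr) * (m * Nr) := by exact_mod_cast hch
    simp only [Fintype.card_prod, Fintype.card_fin, hcJ]
    push_cast
    field_simp
    linarith
  · intro 𝔽 _ _ hq F g hg
    simp only [aeval_stackedDetPolynomial] at hg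
    have := Fintype.ofFinite 𝔽
    rw [Nat.card_eq_fintype_card] at hq
    -- Distinct evaluation points, one per row set, exist because the field size threshold is
    -- `Fintype.card J`.
    obtain ⟨x⟩ := Function.Embedding.nonempty_of_card_le hq
    set y := Sum.elim (fun v : Fin Kc × Fin (m * N) => F v.1 v.2) g with hy
    let G : J → Matrix (Fin m × Fin Nr) (Fin m × Fin N) 𝔽 :=
      fun s => Matrix.of fun x k => y (u s (Sum.inl (x, k)))
    let C : J → Fin N → Matrix (Fin m × Fin Nr) (Fin m) 𝔽 :=
      fun s n => Matrix.of fun x p => y (u s (Sum.inr (n, x, p)))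
    let V : J → Matrix (Fin (m * N)) (Fin (D * L')) 𝔽 → Matrix (Fin m × Fin N) (Fin L') 𝔽 :=
      fun s W => Matrix.of fun k c => ∑ d : Fin D, x s ^ (d : ℕ) *
        regroup W k (finProdFinEquiv (d, c))
    have hGV : ∀ (s : J) (z) (W) (c), (G s * V s W) z c = ∑ d : Fin D, x s ^ (d : ℕ) *
        (F * W) (s.1.orderEmbOfFin (hJ s) (finProdFinEquiv z)) (finProdFinEquiv (d, c)) := by
      intro s z W c
      rw [Matrix.mul_apply]
      simp only [mul_apply_eq_sum_regroup, V, Matrix.of_apply, Finset.mul_sum]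
      rw [Finset.sum_comm]
      refine Finset.sum_congr rfl fun d _ => Finset.sum_congr rfl fun k _ => ?_
      simp only [G, Matrix.of_apply, u, hy, Sum.map_inl, Sum.elim_inl, Prod.map_apply]
      ring
    refine ⟨fun n W z => (annihilator (G z.1) (C z.1) n * (G z.1 * V z.1 W)) z.2.1 z.2.2, ?_, ?_⟩
    · intro n W W' h
      funext z
      dsimp only
      rw [annihilator_mul_mul_congr hNr (V' := V z.1 W')]
      intro k hk
      funext c
      simp only [V, Matrix.of_apply, regroup_apply_congr h k hk]
    · intro A hA W W' h
      have h1 : ∀ s, G s * V s W = G s * V s W' := fun s =>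
        mul_eq_mul_of_annihilator_mul_eq (G := G s) (C := C s) (fun a ha => hg ⟨s, a, ha⟩) hA fun n hn => by
          ext p c
          exact congrFun (h n hn) (s, p, c)
      ext i c
      obtain ⟨⟨d, c⟩, rfl⟩ := finProdFinEquiv.surjective c
      have hcard : (Finset.univ.filter fun s : J => i ∈ s.1).card = D := by
        have hc := card_filter_mem_powersetCard i hk
        rw [Fintype.card_fin] at hc
        rw [hD, ← hc]
        refine Finset.card_bij (fun s _ => s.1) ?_ ?_ ?_
        · intro s hs
          exact Finset.mem_filter.mpr ⟨s.2, (Finset.mem_filter.mp hs).2⟩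
        · intro s _ s' _ h
          exact Subtype.ext h
        · intro s hs
          exact ⟨⟨s, (Finset.mem_filter.mp hs).1⟩, by simpa using (Finset.mem_filter.mp hs).2, rfl⟩
      -- The `D` sets containing `i` give an invertible Vandermonde system for the `D` pieces of row
      -- `i`.
      have hv := eq_zero_of_forall_mem_sum_pow_mul_eq_zero x.injective hcard
        (v := fun d => (F * W) i (finProdFinEquiv (d, c)) - (F * W') i (finProdFinEquiv (d, c)))
        (fun s hs => by
          have his : i ∈ s.1 := (Finset.mem_filter.mp hs).2
          have hr : i ∈ Set.range (s.1.orderEmbOfFin (hJ s)) := by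
            rw [Finset.range_orderEmbOfFin]
            exact his
          obtain ⟨z, hz⟩ := hr
          have h2 := congrFun (congrFun (h1 s) (finProdFinEquiv.symm z)) c
          rw [hGV, hGV, Equiv.apply_symm_apply, hz] at h2
          simp only [mul_sub, Finset.sum_sub_distrib]
          rw [h2, sub_self])
      exact sub_eq_zero.mp (congrFun hv d)

end Regimes

theorem theorem2 (K N Nr Kc M L : ℕ) (hNr : 1 ≤ Nr) (hNrN : Nr ≤ N) (hNK : N ∣ K)
    (hKc : 1 ≤ Kc) (hKcK : Kc ≤ K) (hM : M = K / N * (N - Nr + 1)) (hL : 1 ≤ L) :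
    (Kc < K / N →
      IsAchievableWith K N Nr Kc M L (cyclicAssignment K N Nr) ((Nr : ℝ) * (Kc : ℝ))) ∧
    (K / N ≤ Kc → Kc ≤ K / N * Nr →
      IsAchievableWith K N Nr Kc M L (cyclicAssignment K N Nr)
        ((K : ℝ) / (N : ℝ) * (Nr : ℝ))) ∧
    (K / N * Nr < Kc → (Kc - 1).choose (K / N * Nr - 1) ∣ L →
      IsAchievableWith K N Nr Kc M L (cyclicAssignment K N Nr) (Kc : ℝ)) := by
  have hN : 0 < N := by omega
  have : NeZero Nr := ⟨by omega⟩
  obtain ⟨m, rfl⟩ : ∃ m, K = m * N := hNK.imp fun m h => by rw [h, mul_comm]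
  have hm : 0 < m := pos_of_mul_pos_left (lt_of_lt_of_le hKc hKcK) hN.le
  have hKN : ((m * N : ℕ) : ℝ) / (N : ℝ) = m := by
    have : (N : ℝ) ≠ 0 := by positivity
    push_cast
    field_simp
  rw [hKN]
  rw [Nat.mul_div_cancel _ hN] at hM ⊢
  exact ⟨fun _ => isAchievableWith_mul hNrN hL hM,
    fun _ h => isAchievableWith_of_le_mul hNrN hL hM h,
    fun h hdvd => isAchievableWith_of_mul_lt hNrN hm hL hM h hdvd⟩
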